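/- Let $\mathcal{H}$ be a separable complex Hilbert space and let $H$ be a closed, unbounded, densely defined linear operator in $\mathcal{H}$ with domain $\operatorname{dom} H\subset\mathcal{H}$. Then: (1) there exists a closed linear subspace $\mathfrak{M}$ of $\mathcal{H}$ such that $$\mathfrak{M}\cap\operatorname{dom} H=\mathfrak{M}^{\perp}\cap\operatorname{dom} H=\{0\};$$ moreover, there are uncountably many such subspaces; (2) there exists a fundamental symmetry $J$ in $\mathcal{H}$, that is, a bounded linear operator on $\mathcal{H}$ with $J=J^{*}=J^{-1}$, such that $$J(\operatorname{dom} H)\cap\operatorname{dom} H=\{0\};$$ moreover, there are uncountably many such $J$. -/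

import Mathlib

/-- A linear operator with domain in `E` is unbounded if it admits no bound
`‖H x‖ ≤ C * ‖x‖` on its domain. -/
def LinearPMap.IsUnbounded {E : Type*} [NormedAddCommGroup E] [InnerProductSpace ℂ E]
    (H : E →ₗ.[ℂ] E) : Prop :=
  ¬ ∃ C : ℝ, ∀ x : H.domain, ‖H x‖ ≤ C * ‖(x : E)‖

/-- Fundamental symmetries: bounded operators with `J = J* = J⁻¹`. -/
def IsFundamentalSymmetry {E : Type*} [NormedAddCommGroup E] [InnerProductSpace ℂ E]
    [CompleteSpace E] (J : E →L[ℂ] E) : Prop :=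
  ContinuousLinearMap.adjoint J = J ∧ J ∘L J = ContinuousLinearMap.id ℂ E

/-- The (closed) subspaces `M` with `M ∩ dom H = M^⊥ ∩ dom H = {0}`. -/
def trivialIntersectionSubspaces {E : Type*} [NormedAddCommGroup E] [InnerProductSpace ℂ E]
    (H : E →ₗ.[ℂ] E) : Set (Submodule ℂ E) :=
  {M | IsClosed (M : Set E) ∧ M ⊓ H.domain = ⊥ ∧ Mᗮ ⊓ H.domain = ⊥}

/-- The fundamental symmetries `J` with `J (dom H) ∩ dom H = {0}`. -/
def trivialIntersectionSymmetries {E : Type*} [NormedAddCommGroup E] [InnerProductSpace ℂ E]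
    [CompleteSpace E] (H : E →ₗ.[ℂ] E) : Set (E →L[ℂ] E) :=
  {J | IsFundamentalSymmetry J ∧ H.domain.map (J : E →ₗ[ℂ] E) ⊓ H.domain = ⊥}

/-! The domain of `H` is the range of the projection `R` of its graph to the first factor. By the
open mapping theorem `R` is not surjective, so its adjoint is not bounded below. This yields
orthonormal `e n` on which the adjoint is as small as prescribed, so vectors of the domain have
rapidly decaying coefficients along `e` (`exists_orthonormal_inner_le`).

Mixing the `e (2 * k)` by a unitary matrix of polynomial values `p k (2⁻ʲ)` gives `u j` such that,
for `x` in the domain, `⟪u j, x⟫ = g (2⁻ʲ)` with `g` holomorphic on a disc. If these values are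
`O(2^{-j²})` along a subsequence, `g` has a zero of infinite order at `0`, and all of them vanish
(`exists_orthonormal_quasianalytic`).

Complete `u` by an orthonormal `b` and let `M` be given by `⟪u j, x⟫ = r j * ⟪b j, x⟫`, with `r j`
tiny for even `j` and huge for odd `j`. The `u`-coefficients are tiny at even `j` on `M` and at odd
`j` on `Mᗮ`, so both meet the domain trivially. Multiplying a unit vector of the domain by phases
moves `M` to uncountably many such subspaces, and the reflections in them are the required `J`. -/

open Filter Topology InnerProductSpace

/-! ### Orthonormal sequences on which an adjoint is small -/

section SmallAdjoint

variable {E G : Type*} [NormedAddCommGroup E] [InnerProductSpace ℂ E] [CompleteSpace E]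
  [NormedAddCommGroup G] [InnerProductSpace ℂ G] [CompleteSpace G]

/-- A bounded operator whose adjoint is bounded below is surjective. -/
theorem surjective_of_adjoint_bounded_below (R : G →L[ℂ] E) {ε : ℝ} (hε : 0 < ε)
    (h : ∀ x, ε * ‖x‖ ≤ ‖ContinuousLinearMap.adjoint R x‖) : Function.Surjective R := by
  -- The operator `R R*` is bounded below, so its range is closed; a vector orthogonal to that range
  -- is killed by `R*`, hence zero.
  set S : E →L[ℂ] E := R ∘L ContinuousLinearMap.adjoint R with hS
  have hinner : ∀ x y, ⟪S x, y⟫_ℂ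
      = ⟪ContinuousLinearMap.adjoint R x, ContinuousLinearMap.adjoint R y⟫_ℂ := fun x y => by
    simp [hS, ContinuousLinearMap.adjoint_inner_right]
  have hbelow : ∀ x, ε ^ 2 * ‖x‖ ≤ ‖S x‖ := fun x => by
    rcases eq_or_ne x 0 with rfl | hx
    · simp
    have hx' : 0 < ‖x‖ := norm_pos_iff.2 hx
    have h1 : ‖ContinuousLinearMap.adjoint R x‖ ^ 2 ≤ ‖S x‖ * ‖x‖ := by
      have h2 := hinner x x
      rw [inner_self_eq_norm_sq_to_K] at h2
      have h3 := norm_inner_le_norm (𝕜 := ℂ) (S x) x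
      rw [h2] at h3
      simpa using h3
    have h4 : (ε * ‖x‖) ^ 2 ≤ ‖ContinuousLinearMap.adjoint R x‖ ^ 2 :=
      pow_le_pow_left₀ (by positivity) (h x) 2
    have h5 : (ε ^ 2 * ‖x‖) * ‖x‖ ≤ ‖S x‖ * ‖x‖ := by nlinarith
    exact le_of_mul_le_mul_right h5 hx'
  have hanti : AntilipschitzWith (Real.toNNReal (ε ^ 2)⁻¹) S := by
    refine ContinuousLinearMap.antilipschitz_of_bound S fun x => ?_
    rw [Real.coe_toNNReal _ (by positivity), inv_mul_eq_div, le_div_iff₀ (by positivity), mul_comm]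
    exact hbelow x
  have hclosed : IsClosed (S.range : Set E) := hanti.isClosed_range S.uniformContinuous
  have := hclosed.completeSpace_coe
  have hrange : S.range = ⊤ := by
    rw [← S.range.orthogonal_orthogonal, Submodule.eq_top_iff']
    intro v w hw
    have hw0 : ⟪S w, w⟫_ℂ = 0 := hw _ ⟨w, rfl⟩
    rw [hinner, inner_self_eq_zero] at hw0
    have := h w
    rw [hw0, norm_zero] at this
    have : w = 0 := norm_le_zero_iff.1 (nonpos_of_mul_nonpos_right this hε)
    simp [this]
  intro y
  obtain ⟨x, hx⟩ : y ∈ S.range := hrange ▸ Submodule.mem_top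
  exact ⟨_, hx⟩

theorem exists_norm_eq_one_adjoint_le (R : G →L[ℂ] E) (hR : ¬ Function.Surjective R) {ε : ℝ}
    (hε : 0 < ε) : ∃ x : E, ‖x‖ = 1 ∧ ‖ContinuousLinearMap.adjoint R x‖ ≤ ε := by
  by_contra! h
  refine hR (surjective_of_adjoint_bounded_below R hε fun x => ?_)
  rcases eq_or_ne x 0 with rfl | hx
  · simp
  have hx' : 0 < ‖x‖ := norm_pos_iff.2 hx
  have h1 := (h ((‖x‖⁻¹ : ℂ) • x) (by simp [norm_smul, hx'.ne'])).le
  rw [map_smul, norm_smul, norm_inv, Complex.norm_real, norm_norm, inv_mul_eq_div,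
    le_div_iff₀ hx'] at h1
  exact h1

/-- A bounded sequence on which the adjoint of a map with dense range tends to zero is weakly
null. -/
theorem tendsto_inner_of_tendsto_adjoint (R : G →L[ℂ] E) (hd : DenseRange R) {x : ℕ → E}
    (hx : ∀ n, ‖x n‖ = 1) (h : Tendsto (fun n => ContinuousLinearMap.adjoint R (x n)) atTop (𝓝 0))
    (y : E) : Tendsto (fun n => ⟪y, x n⟫_ℂ) atTop (𝓝 0) := by
  rw [Metric.tendsto_atTop]
  intro δ hδ
  obtain ⟨g, hg⟩ := Metric.denseRange_iff.1 hd y (δ / 2) (by positivity)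
  have h1 : Tendsto (fun n => ⟪g, ContinuousLinearMap.adjoint R (x n)⟫_ℂ) atTop (𝓝 0) := by
    simpa using (tendsto_const_nhds (x := g)).inner (𝕜 := ℂ) h
  obtain ⟨N, hN⟩ := Metric.tendsto_atTop.1 h1 (δ / 2) (by positivity)
  refine ⟨N, fun n hn => ?_⟩
  have h2 := hN n hn
  rw [dist_zero_right, ContinuousLinearMap.adjoint_inner_right] at h2
  have h3 : ⟪y, x n⟫_ℂ = ⟪y - R g, x n⟫_ℂ + ⟪R g, x n⟫_ℂ := by rw [inner_sub_left]; ring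
  have h4 : ‖⟪y - R g, x n⟫_ℂ‖ ≤ dist y (R g) := by
    simpa only [hx, dist_eq_norm, mul_one] using norm_inner_le_norm (𝕜 := ℂ) (y - R g) (x n)
  rw [dist_zero_right, h3]
  linarith [norm_add_le ⟪y - R g, x n⟫_ℂ ⟪R g, x n⟫_ℂ]

/-- Unit vectors with `R* x n → 0` are weakly null, so their projections to the finite-dimensional
`K` tend to zero in norm and can be subtracted. -/
theorem exists_mem_orthogonal_adjoint_le (R : G →L[ℂ] E) (hR : ¬ Function.Surjective R)
    (hd : DenseRange R) (K : Submodule ℂ E) [FiniteDimensional ℂ K] {ε : ℝ} (hε : 0 < ε) :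
    ∃ x ∈ Kᗮ, ‖x‖ = 1 ∧ ‖ContinuousLinearMap.adjoint R x‖ ≤ ε := by
  choose x hx1 hx2 using fun n : ℕ =>
    exists_norm_eq_one_adjoint_le R hR (ε := 1 / ((n : ℝ) + 1)) (by positivity)
  have hA : Tendsto (fun n => ContinuousLinearMap.adjoint R (x n)) atTop (𝓝 0) :=
    squeeze_zero_norm hx2 tendsto_one_div_add_atTop_nhds_zero_nat
  have hP : Tendsto (fun n => K.starProjection (x n)) atTop (𝓝 0) := by
    have h1 : ∀ n, K.starProjection (x n)
        = ∑ i, ⟪(stdOrthonormalBasis ℂ K i : E), x n⟫_ℂ • (stdOrthonormalBasis ℂ K i : E) := by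
      intro n
      rw [Submodule.starProjection_apply, (stdOrthonormalBasis ℂ K).orthogonalProjectionOnto_apply_eq_sum]
      simp
    simp_rw [h1]
    rw [show (0 : E) = ∑ i, (0 : ℂ) • (stdOrthonormalBasis ℂ K i : E) by simp]
    exact tendsto_finsetSum _ fun i _ =>
      (tendsto_inner_of_tendsto_adjoint R hd hx1 hA _).smul_const _
  have hy : Tendsto (fun n => ‖x n - K.starProjection (x n)‖) atTop (𝓝 1) := by
    have h1 : Tendsto (fun n => ‖K.starProjection (x n)‖) atTop (𝓝 0) := by simpa using hP.norm
    have h2 : Tendsto (fun n => 1 - ‖K.starProjection (x n)‖) atTop (𝓝 1) := by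
      simpa using h1.const_sub 1
    have h3 : Tendsto (fun n => 1 + ‖K.starProjection (x n)‖) atTop (𝓝 1) := by
      simpa using h1.const_add 1
    refine tendsto_of_tendsto_of_tendsto_of_le_of_le h2 h3 (fun n => ?_) (fun n => ?_)
    · simpa [hx1] using norm_sub_norm_le (x n) (K.starProjection (x n))
    · simpa [hx1] using norm_sub_le (x n) (K.starProjection (x n))
  have hB : Tendsto (fun n => ‖ContinuousLinearMap.adjoint R (x n - K.starProjection (x n))‖)
      atTop (𝓝 0) := by
    have h1 := ((ContinuousLinearMap.adjoint R).continuous.tendsto 0).comp hP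
    rw [map_zero] at h1
    simpa using (hA.sub h1).norm
  obtain ⟨n, hn1, hn2⟩ := ((hy.eventually (lt_mem_nhds (show (1 / 2 : ℝ) < 1 by norm_num))).and
    (hB.eventually (gt_mem_nhds (show 0 < ε / 2 by positivity)))).exists
  set y := x n - K.starProjection (x n) with hydef
  have hyK : y ∈ Kᗮ := K.sub_starProjection_mem_orthogonal (x n)
  have hy0 : 0 < ‖y‖ := by linarith
  refine ⟨(‖y‖⁻¹ : ℂ) • y, Kᗮ.smul_mem _ hyK, by simp [norm_smul, hy0.ne'], ?_⟩
  rw [map_smul, norm_smul, norm_inv, Complex.norm_real, norm_norm, inv_mul_eq_div,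
    div_le_iff₀ hy0]
  nlinarith

theorem exists_orthonormal_adjoint_le (R : G →L[ℂ] E) (hR : ¬ Function.Surjective R)
    (hd : DenseRange R) {w : ℕ → ℝ} (hw : ∀ n, 0 < w n) (hanti : Antitone w) :
    ∃ e : ℕ → E, Orthonormal ℂ e ∧ ∀ n, ‖ContinuousLinearMap.adjoint R (e n)‖ ≤ w n := by
  -- Each vector carries an index that must strictly increase, so the `n`-th index is at least `n`
  -- and antitonicity of `w` gives the bound.
  obtain ⟨f, hf1, hf2⟩ := exists_seq_of_forall_finset_exists
    (fun p : ℕ × E => ‖p.2‖ = 1 ∧ ‖ContinuousLinearMap.adjoint R p.2‖ ≤ w p.1)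
    (fun p q => p.1 < q.1 ∧ ⟪p.2, q.2⟫_ℂ = 0) (by
      classical
      intro s _
      have : FiniteDimensional ℂ (Submodule.span ℂ (s.image Prod.snd : Set E)) :=
        FiniteDimensional.span_finset ℂ _
      obtain ⟨x, hx, hx1, hx2⟩ := exists_mem_orthogonal_adjoint_le R hR hd
        (Submodule.span ℂ (s.image Prod.snd : Set E)) (hw (s.sup Prod.fst + 1))
      refine ⟨(s.sup Prod.fst + 1, x), ⟨hx1, hx2⟩, fun p hp => ⟨?_, ?_⟩⟩
      · exact Nat.lt_succ_of_le (Finset.le_sup (f := Prod.fst) hp)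
      · exact hx _ (Submodule.subset_span (by exact_mod_cast Finset.mem_image_of_mem _ hp)))
  have hmono : StrictMono fun n => (f n).1 := fun m n hmn => (hf2 m n hmn).1
  refine ⟨fun n => (f n).2, ⟨fun n => (hf1 n).1, fun m n hmn => ?_⟩, fun n =>
    (hf1 n).2.trans (hanti (hmono.id_le n))⟩
  rcases lt_or_gt_of_ne hmn with h | h
  · exact (hf2 m n h).2
  · exact inner_eq_zero_symm.1 (hf2 n m h).2

end SmallAdjoint

/-! ### Decay of coefficients on the domain -/

section Graph

variable {E : Type*} [NormedAddCommGroup E] [InnerProductSpace ℂ E] [CompleteSpace E]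

/-- An unbounded closed densely defined operator admits orthonormal sequences against which the
elements of its domain decay as fast as prescribed. -/
theorem exists_orthonormal_inner_le {H : E →ₗ.[ℂ] E}
    (hunbounded : H.IsUnbounded) (hclosed : H.IsClosed) (hdense : Dense (H.domain : Set E))
    {w : ℕ → ℝ} (hw : ∀ n, 0 < w n) (hanti : Antitone w) :
    ∃ e : ℕ → E, Orthonormal ℂ e ∧ ∀ x ∈ H.domain, ∃ C, ∀ n, ‖⟪e n, x⟫_ℂ‖ ≤ C * w n := by
  -- The `ℓ²` product norm makes the closed graph a Hilbert space, so that `R` has an adjoint.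
  let Γ : Submodule ℂ (WithLp 2 (E × E)) :=
    H.graph.comap (WithLp.prodContinuousLinearEquiv 2 ℂ E E).toLinearMap
  have hΓ : IsClosed (Γ : Set (WithLp 2 (E × E))) :=
    IsClosed.preimage (WithLp.prodContinuousLinearEquiv 2 ℂ E E).continuous hclosed
  have : CompleteSpace Γ := hΓ.completeSpace_coe
  let R : Γ →L[ℂ] E := (ContinuousLinearMap.fst ℂ E E) ∘L
    (WithLp.prodContinuousLinearEquiv 2 ℂ E E).toContinuousLinearMap ∘L Γ.subtypeL
  have hmem : ∀ x (hx : x ∈ H.domain), ∃ g : Γ, R g = x ∧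
      (g : WithLp 2 (E × E)).snd = H ⟨x, hx⟩ := fun x hx =>
    ⟨⟨WithLp.toLp 2 (x, H ⟨x, hx⟩), H.mem_graph ⟨x, hx⟩⟩, rfl, rfl⟩
  have hd : DenseRange R := hdense.mono fun x hx => (hmem x hx).imp fun g hg => hg.1
  have hinj : Function.Injective R := by
    rw [injective_iff_map_eq_zero]
    intro g hg
    have h1 : ((g : WithLp 2 (E × E)).fst, (g : WithLp 2 (E × E)).snd) ∈ H.graph := g.2
    have h2 : (g : WithLp 2 (E × E)).fst = 0 := hg
    have h3 := H.graph_fst_eq_zero_snd h1 h2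
    exact Subtype.ext ((WithLp.prodContinuousLinearEquiv 2 ℂ E E).injective (Prod.ext h2 h3))
  have hR : ¬ Function.Surjective R := by
    intro hsurj
    let e := ContinuousLinearEquiv.ofBijective R (LinearMap.ker_eq_bot.2 hinj)
      (LinearMap.range_eq_top.2 hsurj)
    refine hunbounded ⟨‖(e.symm : E →L[ℂ] Γ)‖, fun x => ?_⟩
    obtain ⟨g, hg1, hg2⟩ := hmem x x.2
    have h1 : e.symm (x : E) = g := by rw [← hg1]; exact e.symm_apply_apply g
    have h2 : ‖H x‖ ≤ ‖g‖ := by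
      rw [← hg2]
      exact WithLp.norm_snd_le (x := (g : WithLp 2 (E × E)))
    rw [← h1] at h2
    exact h2.trans ((e.symm : E →L[ℂ] Γ).le_opNorm x)
  obtain ⟨e, he, hb⟩ := exists_orthonormal_adjoint_le R hR hd hw hanti
  refine ⟨e, he, fun x hx => ?_⟩
  obtain ⟨g, rfl, -⟩ := hmem x hx
  refine ⟨‖g‖, fun n => ?_⟩
  rw [← ContinuousLinearMap.adjoint_inner_left, mul_comm]
  exact (norm_inner_le_norm _ _).trans (mul_le_mul_of_nonneg_right (hb n) (norm_nonneg _))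

end Graph

/-! ### An orthonormal basis of `ℓ²` made of polynomial samples -/

section PolynomialBasis

/-- The degree starts at `1` because samples of a nonzero constant are not square summable. -/
theorem memℓp_geometric (k : ℕ) :
    Memℓp (fun j : ℕ => (((1 / 2 : ℂ) ^ j) ^ (k + 1) : ℂ)) 2 := by
  refine memℓp_gen ?_
  have h : ∀ j : ℕ, ‖(((1 / 2 : ℂ) ^ j) ^ (k + 1) : ℂ)‖ ^ (2 : ENNReal).toReal
      = (((1 / 2 : ℝ) ^ (k + 1)) ^ 2) ^ j := fun j => by
    simp only [norm_pow, ENNReal.toReal_ofNat, Real.rpow_two, norm_div, norm_one,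
      RCLike.norm_ofNat, ← pow_mul]
    congr 1
    ring
  simp_rw [h]
  refine summable_geometric_of_lt_one (by positivity) ?_
  exact pow_lt_one₀ (by positivity) (pow_lt_one₀ (by norm_num) (by norm_num) (by simp)) two_ne_zero

/-- The samples at the points `2⁻ʲ` of the monomial of degree `k + 1`. -/
noncomputable def geometricVector (k : ℕ) : lp (fun _ : ℕ => ℂ) 2 :=
  ⟨fun j => ((1 / 2 : ℂ) ^ j) ^ (k + 1), memℓp_geometric k⟩

theorem geometricVector_apply (k j : ℕ) :
    geometricVector k j = ((1 / 2 : ℂ) ^ j) ^ (k + 1) := rfl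

/-- Let `n` be the first index with `y n ≠ 0`. After scaling the `k`-th relation by `2^{n(k+1)}`,
the terms beyond `n` vanish as `k → ∞` by dominated convergence, which forces `y n = 0`. -/
theorem eq_zero_of_inner_geometricVector (y : lp (fun _ : ℕ => ℂ) 2)
    (hy : ∀ k, ⟪geometricVector k, y⟫_ℂ = 0) : y = 0 := by
  classical
  by_contra hne
  have hex : ∃ n, y n ≠ 0 := by
    by_contra! h
    exact hne (lp.ext (funext h))
  set n := Nat.find hex with hn
  have hn0 : y n ≠ 0 := Nat.find_spec hex
  have hlt : ∀ j < n, y j = 0 := fun j hj => not_not.1 (Nat.find_min hex hj)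
  let r : ℕ → ℝ := fun j => 2 ^ n * (1 / 2) ^ j
  have hr0 : ∀ j, 0 ≤ r j := fun j => by positivity
  have hrn : r n = 1 := by simp [r]
  have hr1 : ∀ j, n < j → r j < 1 := fun j hj => by
    rw [← hrn]
    exact mul_lt_mul_of_pos_left (pow_lt_pow_right_of_lt_one₀ (by norm_num) (by norm_num) hj)
      (by positivity)
  have hlim : Tendsto (fun k : ℕ => ∑' j, ((r j : ℂ) ^ (k + 1) * y j)) atTop
      (𝓝 (∑' j, if j = n then y n else 0)) := by
    refine tendsto_tsum_of_dominated_convergence (bound := fun j => r j * ‖y‖) ?_ ?_ ?_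
    · exact ((summable_geometric_of_lt_one (by norm_num) (by norm_num)).mul_left _).mul_right _
    · intro j
      rcases lt_trichotomy j n with h | rfl | h
      · simp [hlt j h, h.ne]
      · simp [hrn]
      · have h1 : Tendsto (fun k : ℕ => (r j : ℂ) ^ (k + 1)) atTop (𝓝 0) := by
          refine (tendsto_pow_atTop_nhds_zero_of_norm_lt_one ?_).comp (tendsto_add_atTop_nat 1)
          rw [Complex.norm_real, Real.norm_of_nonneg (hr0 j)]
          exact hr1 j h
        simpa [h.ne'] using h1.mul_const (y j)
    · refine Eventually.of_forall fun k j => ?_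
      rcases lt_or_ge j n with h | h
      · rw [hlt j h]
        simpa using mul_nonneg (hr0 j) (norm_nonneg y)
      · have h1 : r j ≤ 1 := by
          rcases h.eq_or_lt with h | h
          · rw [← h, hrn]
          · exact (hr1 j h).le
        rw [norm_mul, norm_pow, Complex.norm_real, Real.norm_of_nonneg (hr0 j)]
        refine mul_le_mul ?_ (lp.norm_apply_le_norm two_ne_zero y j) (norm_nonneg _) (hr0 j)
        exact pow_le_of_le_one (hr0 j) h1 (Nat.succ_ne_zero k)
  have hzero : ∀ k : ℕ, ∑' j, ((r j : ℂ) ^ (k + 1) * y j) = 0 := fun k => by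
    have h1 := hy k
    rw [lp.inner_eq_tsum] at h1
    have h2 : ∀ j, (r j : ℂ) ^ (k + 1) * y j
        = ((2 : ℂ) ^ n) ^ (k + 1) * ⟪geometricVector k j, y j⟫_ℂ := fun j => by
      have h3 : (starRingEnd ℂ) (geometricVector k j) = ((1 / 2 : ℂ) ^ j) ^ (k + 1) := by
        rw [geometricVector_apply, map_pow, map_pow, map_div₀, map_one, map_ofNat]
      rw [RCLike.inner_apply, h3]
      simp only [r]
      push_cast
      ring
    simp_rw [h2]
    rw [tsum_mul_left, h1, mul_zero]
  simp_rw [hzero] at hlim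
  rw [tsum_ite_eq] at hlim
  exact hn0 (tendsto_nhds_unique hlim tendsto_const_nhds)

/-- The samples at the points `2⁻ʲ` of the polynomial `X * q`. -/
noncomputable def polynomialSamples : Polynomial ℂ →ₗ[ℂ] lp (fun _ : ℕ => ℂ) 2 :=
  (Polynomial.basisMonomials ℂ).constr ℂ geometricVector

theorem polynomialSamples_monomial (k : ℕ) (c : ℂ) :
    polynomialSamples (Polynomial.monomial k c) = c • geometricVector k := by
  have h := (Polynomial.basisMonomials ℂ).constr_basis ℂ geometricVector k
  rw [← mul_one c, ← smul_eq_mul, ← Polynomial.smul_monomial, map_smul, smul_eq_mul, mul_one, ← h]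
  simp [polynomialSamples]

theorem polynomialSamples_apply (q : Polynomial ℂ) (j : ℕ) :
    polynomialSamples q j = (Polynomial.X * q).eval ((1 / 2 : ℂ) ^ j) := by
  induction q using Polynomial.induction_on' with
  | add p q hp hq =>
    rw [map_add, lp.coeFn_add, Pi.add_apply, hp, hq, mul_add, Polynomial.eval_add]
  | monomial k c =>
    rw [polynomialSamples_monomial, lp.coeFn_smul, Pi.smul_apply, geometricVector_apply]
    simp only [smul_eq_mul, Polynomial.eval_mul, Polynomial.eval_X, Polynomial.eval_monomial]
    ring

theorem injective_half_pow : Function.Injective fun j : ℕ => ((1 / 2 : ℂ) ^ j) := by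
  intro i j h
  have h1 : (1 / 2 : ℝ) ^ i = (1 / 2 : ℝ) ^ j := by
    have h2 := congrArg norm h
    simpa only [norm_pow, norm_div, norm_one, RCLike.norm_ofNat] using h2
  exact pow_right_injective₀ (by norm_num) (by norm_num) h1

theorem polynomialSamples_injective : Function.Injective polynomialSamples := by
  rw [injective_iff_map_eq_zero]
  intro q hq
  have h : Polynomial.X * q = 0 := by
    refine Polynomial.eq_zero_of_infinite_isRoot _ ?_
    refine (Set.infinite_range_of_injective injective_half_pow).mono ?_
    rintro _ ⟨j, rfl⟩
    change (Polynomial.X * q).eval ((1 / 2 : ℂ) ^ j) = 0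
    rw [← polynomialSamples_apply, hq]
    rfl
  exact (mul_eq_zero.1 h).resolve_left Polynomial.X_ne_zero

/-- There is an orthonormal basis of `ℓ²` that consists of samples of polynomials at the points
`2⁻ʲ`. -/
theorem exists_hilbertBasis_polynomial :
    ∃ (P : HilbertBasis ℕ ℂ (lp (fun _ : ℕ => ℂ) 2)) (p : ℕ → Polynomial ℂ),
      ∀ k j, P k j = (p k).eval ((1 / 2 : ℂ) ^ j) := by
  have hv : polynomialSamples ∘ (Polynomial.basisMonomials ℂ) = geometricVector := by
    funext k
    simp [polynomialSamples_monomial]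
  have hli : LinearIndependent ℂ geometricVector := by
    rw [← hv]
    exact (Polynomial.basisMonomials ℂ).linearIndependent.map' _
      (LinearMap.ker_eq_bot.2 polynomialSamples_injective)
  -- Gram–Schmidt preserves the span, so its output is total and still consists of polynomial
  -- samples.
  have hspan : Submodule.span ℂ (Set.range (InnerProductSpace.gramSchmidtNormed ℂ geometricVector))
      = Submodule.span ℂ (Set.range geometricVector) := by
    rw [InnerProductSpace.span_gramSchmidtNormed_range, InnerProductSpace.span_gramSchmidt]
  have hsp : (Submodule.span ℂ
      (Set.range (InnerProductSpace.gramSchmidtNormed ℂ geometricVector)))ᗮ = ⊥ := by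
    rw [hspan, Submodule.eq_bot_iff]
    exact fun y hy => eq_zero_of_inner_geometricVector y fun k =>
      hy _ (Submodule.subset_span ⟨k, rfl⟩)
  have hmem : ∀ k, ∃ q : Polynomial ℂ,
      polynomialSamples q = InnerProductSpace.gramSchmidtNormed ℂ geometricVector k := fun k => by
    have h1 : InnerProductSpace.gramSchmidtNormed ℂ geometricVector k ∈
        Submodule.span ℂ (Set.range geometricVector) := by
      rw [← hspan]
      exact Submodule.subset_span ⟨k, rfl⟩
    have h2 : Submodule.span ℂ (Set.range geometricVector) ≤ LinearMap.range polynomialSamples := by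
      rw [Submodule.span_le]
      rintro _ ⟨i, rfl⟩
      exact ⟨Polynomial.basisMonomials ℂ i, congrFun hv i⟩
    exact h2 h1
  choose q hq using hmem
  refine ⟨HilbertBasis.mkOfOrthogonalEqBot
    (InnerProductSpace.gramSchmidtNormed_orthonormal hli) hsp, fun k => Polynomial.X * q k,
    fun k j => ?_⟩
  rw [HilbertBasis.coe_mkOfOrthogonalEqBot, ← hq, polynomialSamples_apply]

end PolynomialBasis

/-! ### Holomorphic functions with fast decay along `2⁻ʲ` -/

section Analytic

/-- A holomorphic function which along a subsequence of `2⁻ʲ` is of size `O(2^{-j²})` vanishes. -/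
theorem eqOn_zero_of_frequently_norm_le {g : ℂ → ℂ} (hg : DifferentiableOn ℂ g (Metric.ball 0 2))
    {C : ℝ} (h : ∃ᶠ j : ℕ in atTop, ‖g ((1 / 2 : ℂ) ^ j)‖ ≤ C * (1 / 2) ^ (j ^ 2)) :
    Set.EqOn g 0 (Metric.ball 0 2) := by
  have hA : AnalyticOnNhd ℂ g (Metric.ball 0 2) := hg.analyticOnNhd Metric.isOpen_ball
  have h0 : (0 : ℂ) ∈ Metric.ball (0 : ℂ) 2 := Metric.mem_ball_self two_pos
  by_cases hz : ∀ᶠ z in 𝓝 (0 : ℂ), g z = 0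
  · exact hA.eqOn_zero_of_preconnected_of_eventuallyEq_zero
      (convex_ball (0 : ℂ) 2).isPreconnected h0 hz
  exfalso
  -- A zero of finite order `m` gives size at least a constant times `2^{-jm}` at `2⁻ʲ`, which
  -- exceeds `C * 2^{-j²}` for large `j`.
  obtain ⟨m, f, hf, hf0, hgf⟩ := (hA 0 h0).exists_eventuallyEq_pow_smul_nonzero_iff.2 hz
  have hpos : 0 < ‖f 0‖ := norm_pos_iff.2 hf0
  have hlim : Tendsto (fun j : ℕ => (1 / 2 : ℂ) ^ j) atTop (𝓝 0) :=
    tendsto_pow_atTop_nhds_zero_of_norm_lt_one (by norm_num)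
  have hE1 := hlim.eventually hgf
  have hE2 := hlim.eventually
    (hf.continuousAt.norm.eventually (lt_mem_nhds (half_lt_self hpos)))
  have hE3 : ∀ᶠ j : ℕ in atTop, |C| * (1 / 2 : ℝ) ^ j < ‖f 0‖ / 2 := by
    have h1 : Tendsto (fun j : ℕ => |C| * (1 / 2 : ℝ) ^ j) atTop (𝓝 0) := by
      simpa using (tendsto_pow_atTop_nhds_zero_of_lt_one (r := (1 / 2 : ℝ))
        (by norm_num) (by norm_num)).const_mul |C|
    exact h1.eventually (gt_mem_nhds (by positivity))
  obtain ⟨j, hj, h1, h2, h3, h4⟩ :=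
    (h.and_eventually (hE1.and (hE2.and (hE3.and (eventually_ge_atTop (m + 1)))))).exists
  rw [h1, sub_zero, norm_smul, norm_pow, norm_pow, norm_div, norm_one, RCLike.norm_ofNat,
    ← pow_mul] at hj
  have h5 : (1 / 2 : ℝ) ^ (j ^ 2) ≤ (1 / 2) ^ (j * m) * (1 / 2) ^ j := by
    rw [← pow_add]
    refine pow_le_pow_of_le_one (by norm_num) (by norm_num) ?_
    nlinarith
  have h6 : (0 : ℝ) < (1 / 2) ^ (j * m) := by positivity
  have h7 : C * (1 / 2 : ℝ) ^ (j ^ 2) ≤ |C| * ((1 / 2) ^ (j * m) * (1 / 2) ^ j) :=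
    mul_le_mul (le_abs_self C) h5 (by positivity) (abs_nonneg C)
  nlinarith

theorem differentiableOn_tsum_mul_eval {p : ℕ → Polynomial ℂ} {B w : ℕ → ℝ} {a : ℕ → ℂ} {C : ℝ}
    (hB : ∀ k, ∀ z ∈ Metric.ball (0 : ℂ) 2, ‖(p k).eval z‖ ≤ B k)
    (hw : ∀ k, w k * B k ≤ (1 / 2) ^ k) (ha : ∀ k, ‖a k‖ ≤ C * w k) (hC : 0 ≤ C) :
    DifferentiableOn ℂ (fun z => ∑' k, (p k).eval z * a k) (Metric.ball 0 2) := by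
  refine Complex.differentiableOn_tsum_of_summable_norm (u := fun k => C * (1 / 2) ^ k)
    ((summable_geometric_of_lt_one (by norm_num) (by norm_num)).mul_left C)
    (fun k => ((p k).differentiable.mul_const _).differentiableOn) Metric.isOpen_ball ?_
  intro k z hz
  have hB0 : 0 ≤ B k := (norm_nonneg _).trans (hB k z hz)
  rw [norm_mul]
  calc ‖(p k).eval z‖ * ‖a k‖ ≤ B k * (C * w k) :=
        mul_le_mul (hB k z hz) (ha k) (norm_nonneg _) hB0
    _ = C * (w k * B k) := by ring
    _ ≤ C * (1 / 2) ^ k := mul_le_mul_of_nonneg_left (hw k) hC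

theorem exists_antitone_mul_le (B : ℕ → ℝ) :
    ∃ w : ℕ → ℝ, (∀ k, 0 < w k) ∧ Antitone w ∧ ∀ k, w k * B k ≤ (1 / 2) ^ k := by
  have hpos : ∀ k, 0 < 1 + ∑ i ∈ Finset.range (k + 1), |B i| := fun k => by
    have := Finset.sum_nonneg fun i (_ : i ∈ Finset.range (k + 1)) => abs_nonneg (B i)
    linarith
  refine ⟨fun k => (1 / 2) ^ k / (1 + ∑ i ∈ Finset.range (k + 1), |B i|),
    fun k => div_pos (by positivity) (hpos k), antitone_nat_of_succ_le fun k => ?_, fun k => ?_⟩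
  · refine div_le_div₀ (by positivity) ?_ (hpos k) ?_
    · exact pow_le_pow_of_le_one (by norm_num) (by norm_num) (Nat.le_succ k)
    · rw [Finset.sum_range_succ _ (k + 1)]
      linarith [abs_nonneg (B (k + 1))]
  · rw [div_mul_eq_mul_div, div_le_iff₀ (hpos k)]
    refine mul_le_mul_of_nonneg_left ?_ (by positivity)
    have := Finset.single_le_sum (f := fun i => |B i|) (fun i _ => abs_nonneg _)
      (Finset.self_mem_range_succ k)
    linarith [le_abs_self (B k)]

theorem exists_norm_eval_le (q : Polynomial ℂ) :
    ∃ B : ℝ, ∀ z ∈ Metric.ball (0 : ℂ) 2, ‖q.eval z‖ ≤ B := by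
  obtain ⟨B, hB⟩ := (isCompact_closedBall (0 : ℂ) 2).exists_bound_of_continuousOn
    q.continuous.continuousOn
  exact ⟨B, fun z hz => hB z (Metric.ball_subset_closedBall hz)⟩

end Analytic

/-! ### Changing and completing orthonormal families -/

section OrthonormalFamilies

variable {E : Type*} [NormedAddCommGroup E] [InnerProductSpace ℂ E] [CompleteSpace E]

/-- Change of an orthonormal family by the unitary matrix with columns `P k`. -/
theorem Orthonormal.exists_change_hilbertBasis {e : ℕ → E} (he : Orthonormal ℂ e)
    (P : HilbertBasis ℕ ℂ (lp (fun _ : ℕ => ℂ) 2)) :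
    ∃ u : ℕ → E, Orthonormal ℂ u ∧ (∀ x j, HasSum (fun k => P k j * ⟪e k, x⟫_ℂ) ⟪u j, x⟫_ℂ) ∧
      ∀ x, (∀ j, ⟪u j, x⟫_ℂ = 0) → ∀ k, ⟪e k, x⟫_ℂ = 0 := by
  classical
  -- The isometry `Φ` sends `P k` to `e k`; the new family is the image of the standard basis, and
  -- the expansion is Parseval's identity for `P`.
  let Φ : lp (fun _ : ℕ => ℂ) 2 →ₗᵢ[ℂ] E :=
    he.orthogonalFamily.linearIsometry.comp P.repr.toLinearIsometry
  have hΦ : ∀ k, Φ (P k) = e k := fun k => by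
    change he.orthogonalFamily.linearIsometry (P.repr (P k)) = e k
    rw [P.repr_self, OrthogonalFamily.linearIsometry_apply_single]
    simp
  let A := ContinuousLinearMap.adjoint Φ.toContinuousLinearMap
  have hA : ∀ y x, ⟪Φ y, x⟫_ℂ = ⟪y, A x⟫_ℂ := fun y x =>
    (ContinuousLinearMap.adjoint_inner_right Φ.toContinuousLinearMap y x).symm
  have hu : ∀ x j, ⟪Φ (lp.single 2 j (1 : ℂ)), x⟫_ℂ = A x j := fun x j => by
    rw [hA, lp.inner_single_left]
    simp
  refine ⟨fun j => Φ (lp.single 2 j (1 : ℂ)), ?_, fun x j => ?_, fun x hx k => ?_⟩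
  · rw [orthonormal_iff_ite]
    intro i j
    rw [Φ.inner_map_map, lp.inner_single_left, lp.single_apply]
    by_cases h : i = j
    · subst h; simp
    · simp [h]
  · have h := P.hasSum_inner_mul_inner (lp.single 2 j (1 : ℂ)) (A x)
    rw [← hA] at h
    refine h.congr_fun fun k => ?_
    rw [lp.inner_single_left, ← hΦ, hA]
    simp
  · have h0 : A x = 0 := lp.ext (funext fun j => (hu x j).symm.trans (hx j))
    rw [← hΦ, hA, h0, inner_zero_right]

theorem Orthonormal.countable_of_separableSpace {F : Type*} [NormedAddCommGroup F]
    [InnerProductSpace ℂ F] [TopologicalSpace.SeparableSpace F] {s : Set F}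
    (hs : Orthonormal ℂ ((↑) : s → F)) : s.Countable := by
  have hdist : ∀ x ∈ s, ∀ y ∈ s, x ≠ y → 1 ≤ dist x y := by
    intro x hx y hy hxy
    have h0 : ⟪x, y⟫_ℂ = 0 := hs.2 (i := ⟨x, hx⟩) (j := ⟨y, hy⟩) (by simpa using hxy)
    have h1 : ‖x‖ = 1 := hs.1 ⟨x, hx⟩
    have h2 : ⟪x, x - y⟫_ℂ = 1 := by
      rw [inner_sub_right, h0, inner_self_eq_norm_sq_to_K, h1]
      simp
    have h3 := norm_inner_le_norm (𝕜 := ℂ) x (x - y)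
    rw [h2, h1] at h3
    simpa [dist_eq_norm] using h3
  refine Set.PairwiseDisjoint.countable_of_isOpen (s := fun x => Metric.ball x (1 / 2)) ?_
    (fun _ _ => Metric.isOpen_ball) (fun x _ => ⟨x, Metric.mem_ball_self (by norm_num)⟩)
  intro x hx y hy hxy
  refine Metric.ball_disjoint_ball ?_
  linarith [hdist x hx y hy hxy]

/-- The terms of even index of an orthonormal sequence of a separable space can be completed to a
total orthonormal family by a sequence. -/
theorem Orthonormal.exists_complement_even [TopologicalSpace.SeparableSpace E] {e : ℕ → E}
    (he : Orthonormal ℂ e) :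
    ∃ b : ℕ → E, Orthonormal ℂ b ∧ (∀ k j, ⟪e (2 * k), b j⟫_ℂ = 0) ∧
      ∀ x, (∀ k, ⟪e (2 * k), x⟫_ℂ = 0) → (∀ j, ⟪b j, x⟫_ℂ = 0) → x = 0 := by
  obtain ⟨w, B, hw, hB⟩ := he.toSubtypeRange.exists_hilbertBasis_extension
  have hwo : Orthonormal ℂ ((↑) : w → E) := hB ▸ B.orthonormal
  set r : Set E := w \ Set.range fun k => e (2 * k) with hr
  have hrc : r.Countable := hwo.countable_of_separableSpace.mono Set.sdiff_subset
  -- The odd terms of `e` were left out to make the complement infinite, so that `ℕ` indexes it and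
  -- it can be paired with `u`.
  have hri : r.Infinite := by
    have hinj : Function.Injective fun k => e (2 * k + 1) := fun i j h => by
      have := he.linearIndependent.injective h
      omega
    refine (Set.infinite_range_of_injective hinj).mono ?_
    rintro _ ⟨k, rfl⟩
    refine ⟨hw ⟨_, rfl⟩, ?_⟩
    rintro ⟨i, hi⟩
    have := he.linearIndependent.injective hi
    omega
  have := hrc.to_subtype
  have := hri.to_subtype
  obtain ⟨φ⟩ : Nonempty (ℕ ≃ r) := nonempty_equiv_of_countable
  refine ⟨fun j => φ j, ?_, fun k j => ?_, fun x hx1 hx2 => ?_⟩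
  · exact hwo.comp (fun j => ⟨φ j, (φ j).2.1⟩) fun i j h =>
      φ.injective (Subtype.ext (by simpa using h))
  · refine hwo.2 (i := ⟨e (2 * k), hw ⟨_, rfl⟩⟩) (j := ⟨φ j, (φ j).2.1⟩) fun h => ?_
    exact (φ j).2.2 ⟨k, congrArg Subtype.val h⟩
  · have h0 : B.repr x = 0 := lp.ext (funext fun i => by
      rw [B.repr_apply_apply, hB]
      by_cases hi : (i : E) ∈ Set.range fun k => e (2 * k)
      · obtain ⟨k, hk⟩ := hi
        rw [← hk]
        exact hx1 k
      · have h1 := hx2 (φ.symm ⟨i, i.2, hi⟩)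
        simp only [φ.apply_symm_apply] at h1
        exact h1)
    simpa using h0

end OrthonormalFamilies

/-! ### Construction of one subspace -/

section Existence

variable {E : Type*} [NormedAddCommGroup E] [InnerProductSpace ℂ E] [CompleteSpace E]

/-- An unbounded closed densely defined operator admits a total orthonormal family, half of which
is quasi-analytic with respect to the domain of the operator: along no subsequence do the
coefficients of a vector of the domain decay like `2^{-j²}`, unless they all vanish. -/
theorem exists_orthonormal_quasianalytic [TopologicalSpace.SeparableSpace E] {H : E →ₗ.[ℂ] E}
    (hclosed : H.IsClosed) (hdense : Dense (H.domain : Set E)) (hunbounded : H.IsUnbounded) :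
    ∃ u b : ℕ → E, Orthonormal ℂ u ∧ Orthonormal ℂ b ∧ (∀ i j, ⟪u i, b j⟫_ℂ = 0) ∧
      (∀ x, (∀ j, ⟪u j, x⟫_ℂ = 0) → (∀ j, ⟪b j, x⟫_ℂ = 0) → x = 0) ∧
      ∀ x ∈ H.domain, ∀ C : ℝ, (∃ᶠ j : ℕ in atTop, ‖⟪u j, x⟫_ℂ‖ ≤ C * (1 / 2) ^ (j ^ 2)) →
        ∀ j, ⟪u j, x⟫_ℂ = 0 := by
  -- The polynomials come first: their bounds on the disc dictate the weights `w`, and only then is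
  -- `e` chosen.
  obtain ⟨P, p, hPp⟩ := exists_hilbertBasis_polynomial
  choose B hB using fun k => exists_norm_eval_le (p k)
  obtain ⟨w, hw0, hwanti, hwB⟩ := exists_antitone_mul_le B
  obtain ⟨e, he, hedom⟩ := exists_orthonormal_inner_le hunbounded hclosed hdense hw0 hwanti
  obtain ⟨b, hb, heb, htotal⟩ := he.exists_complement_even
  have he2 : Orthonormal ℂ fun k => e (2 * k) := he.comp (fun k => 2 * k) fun i j h => by
    simpa using h
  obtain ⟨u, hu, hsum, hu0⟩ := he2.exists_change_hilbertBasis P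
  refine ⟨u, b, hu, hb, fun i j => ?_, fun x hx1 hx2 => htotal x (hu0 x hx1) hx2,
    fun x hx C hfreq j => ?_⟩
  · have h := hsum (b j) i
    simp only [heb, mul_zero] at h
    exact h.unique hasSum_zero
  · obtain ⟨D, hD⟩ := hedom x hx
    have hD0 : 0 ≤ D := nonneg_of_mul_nonneg_left ((norm_nonneg _).trans (hD 0)) (hw0 0)
    have ha : ∀ k, ‖⟪e (2 * k), x⟫_ℂ‖ ≤ D * w k := fun k =>
      (hD (2 * k)).trans (mul_le_mul_of_nonneg_left (hwanti (by omega)) hD0)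
    have hval : ∀ j, ∑' k, (p k).eval ((1 / 2 : ℂ) ^ j) * ⟪e (2 * k), x⟫_ℂ = ⟪u j, x⟫_ℂ :=
      fun j => by simpa only [hPp] using (hsum x j).tsum_eq
    have hg := eqOn_zero_of_frequently_norm_le (differentiableOn_tsum_mul_eval hB hwB ha hD0)
      (C := C) (by simpa only [hval] using hfreq)
    -- The radius `2` lets the disc contain every sample point, including `1` at `j = 0`.
    have hmem : (1 / 2 : ℂ) ^ j ∈ Metric.ball (0 : ℂ) 2 := by
      rw [mem_ball_zero_iff, norm_pow]
      have : ‖(1 / 2 : ℂ)‖ ^ j ≤ 1 := pow_le_one₀ (norm_nonneg _) (by norm_num)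
      linarith
    rw [← hval]
    exact hg hmem

theorem trivialIntersectionSubspaces_nonempty [TopologicalSpace.SeparableSpace E]
    {H : E →ₗ.[ℂ] E} (hclosed : H.IsClosed) (hdense : Dense (H.domain : Set E))
    (hunbounded : H.IsUnbounded) : (trivialIntersectionSubspaces H).Nonempty := by
  obtain ⟨u, b, hu, hb, hub, htotal, hquasi⟩ :=
    exists_orthonormal_quasianalytic hclosed hdense hunbounded
  let r : ℕ → ℝ := fun j => if Even j then (1 / 2) ^ (j ^ 2) else 2 ^ (j ^ 2)
  have hr0 : ∀ j, r j ≠ 0 := fun j => by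
    simp only [r]
    split_ifs <;> positivity
  have hbu : ∀ i j, ⟪b i, u j⟫_ℂ = 0 := fun i j => inner_eq_zero_symm.1 (hub j i)
  have hu1 : ∀ j, ‖u j‖ = 1 := hu.1
  have hb1 : ∀ j, ‖b j‖ = 1 := hb.1
  let M : Submodule ℂ E := (Submodule.span ℂ (Set.range fun j => (r j : ℂ) • b j - u j))ᗮ
  have hM : ∀ x ∈ M, ∀ j, ⟪u j, x⟫_ℂ = r j * ⟪b j, x⟫_ℂ := fun x hx j => by
    have h := hx _ (Submodule.subset_span ⟨j, rfl⟩)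
    rw [inner_sub_left, inner_smul_left, Complex.conj_ofReal, sub_eq_zero] at h
    exact h.symm
  -- These vectors of `M` yield the relations satisfied on `Mᗮ`, with the roles of `u` and `b`
  -- exchanged up to sign.
  have hmem : ∀ j, b j + (r j : ℂ) • u j ∈ M := fun j => by
    rw [Submodule.mem_orthogonal]
    intro y hy
    induction hy using Submodule.span_induction with
    | mem y hy =>
      obtain ⟨i, rfl⟩ := hy
      simp only [inner_sub_left, inner_add_right, inner_smul_left, inner_smul_right, hub, hbu,
        Complex.conj_ofReal, orthonormal_iff_ite.1 hu, orthonormal_iff_ite.1 hb]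
      by_cases h : i = j
      · subst h; simp
      · simp [h]
    | zero => simp
    | add y z _ _ hy hz => rw [inner_add_left, hy, hz, add_zero]
    | smul c y _ hy => rw [inner_smul_left, hy, mul_zero]
  have hMo : ∀ x ∈ Mᗮ, ∀ j, ⟪b j, x⟫_ℂ = -(r j * ⟪u j, x⟫_ℂ) := fun x hx j => by
    have h := hx _ (hmem j)
    rw [inner_add_left, inner_smul_left, Complex.conj_ofReal] at h
    exact eq_neg_of_add_eq_zero_left h
  refine ⟨M, Submodule.isClosed_orthogonal _, ?_, ?_⟩
  · rw [Submodule.eq_bot_iff]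
    rintro x ⟨hxM, hxD⟩
    have h0 : ∀ j, ⟪u j, x⟫_ℂ = 0 := by
      refine hquasi x hxD ‖x‖ (Nat.frequently_even.mono fun j hj => ?_)
      have h1 : ‖⟪b j, x⟫_ℂ‖ ≤ ‖x‖ := by
        simpa only [hb1, one_mul] using norm_inner_le_norm (𝕜 := ℂ) (b j) x
      rw [hM x hxM j, norm_mul, Complex.norm_real, mul_comm]
      refine mul_le_mul h1 ?_ (norm_nonneg _) (norm_nonneg _)
      simp [r, hj]
    refine htotal x h0 fun j => ?_
    have h1 := hM x hxM j
    rw [h0 j] at h1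
    exact (mul_eq_zero.1 h1.symm).resolve_left (by exact_mod_cast hr0 j)
  · rw [Submodule.eq_bot_iff]
    rintro x ⟨hxM, hxD⟩
    have h0 : ∀ j, ⟪u j, x⟫_ℂ = 0 := by
      refine hquasi x hxD ‖x‖ (Nat.frequently_odd.mono fun j hj => ?_)
      have h1 : ‖⟪b j, x⟫_ℂ‖ ≤ ‖x‖ := by
        simpa only [hb1, one_mul] using norm_inner_le_norm (𝕜 := ℂ) (b j) x
      rw [hMo x hxM j, norm_neg, norm_mul, Complex.norm_real] at h1
      have h2 : ‖r j‖ = 2 ^ (j ^ 2) := by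
        simp [r, Nat.not_even_iff_odd.2 hj]
      rw [h2] at h1
      rwa [one_div, inv_pow, ← div_eq_mul_inv, le_div_iff₀ (by positivity), mul_comm]
    refine htotal x h0 fun j => ?_
    rw [hMo x hxM j, h0 j, mul_zero, neg_zero]

end Existence

/-! ### Uncountably many subspaces by phase rotation -/

section Rotation

variable {E : Type*} [NormedAddCommGroup E] [InnerProductSpace ℂ E]

/-- The linear map that multiplies the unit vector `e` by `c` and fixes its orthogonal
complement. -/
noncomputable def phaseMap (e : E) (c : ℂ) : E →ₗ[ℂ] E :=
  LinearMap.id + (c - 1) • (innerSL ℂ e : E →ₗ[ℂ] ℂ).smulRight e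

theorem phaseMap_apply (e : E) (c : ℂ) (x : E) :
    phaseMap e c x = x + ((c - 1) * ⟪e, x⟫_ℂ) • e := by
  simp [phaseMap, smul_smul]

theorem phaseMap_phaseMap {e : E} (he : ‖e‖ = 1) (c d : ℂ) (x : E) :
    phaseMap e c (phaseMap e d x) = phaseMap e (c * d) x := by
  have h1 : ⟪e, e⟫_ℂ = 1 := by rw [inner_self_eq_norm_sq_to_K, he]; simp
  simp only [phaseMap_apply, inner_add_right, inner_smul_right, h1]
  module

theorem phaseMap_one (e : E) (x : E) : phaseMap e 1 x = x := by simp [phaseMap_apply]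

theorem norm_phaseMap {e : E} (he : ‖e‖ = 1) (c : Circle) (x : E) : ‖phaseMap e c x‖ = ‖x‖ := by
  have h1 : ⟪e, e⟫_ℂ = 1 := by rw [inner_self_eq_norm_sq_to_K, he]; simp
  have hc : (starRingEnd ℂ) (c : ℂ) * c = 1 := by
    rw [mul_comm, Complex.mul_conj, Circle.normSq_coe, Complex.ofReal_one]
  have h2 : ⟪phaseMap e c x, phaseMap e c x⟫_ℂ = ⟪x, x⟫_ℂ := by
    simp only [phaseMap_apply, inner_add_right, inner_add_left, inner_smul_right, inner_smul_left,
      h1, map_mul, map_sub, map_one, inner_conj_symm]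
    linear_combination ⟪e, x⟫_ℂ * ⟪x, e⟫_ℂ * hc
  rw [inner_self_eq_norm_sq_to_K, inner_self_eq_norm_sq_to_K] at h2
  have h3 : ‖phaseMap e c x‖ ^ 2 = ‖x‖ ^ 2 := by exact_mod_cast h2
  exact (sq_eq_sq₀ (norm_nonneg _) (norm_nonneg _)).1 h3

/-- `phaseMap` as a unitary operator. -/
noncomputable def phaseEquiv (e : E) (he : ‖e‖ = 1) (c : Circle) : E ≃ₗᵢ[ℂ] E where
  toLinearEquiv := LinearEquiv.ofLinearMap (phaseMap e c) (phaseMap e (c⁻¹ : Circle))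
    (LinearMap.ext fun x => by
      simp [phaseMap_phaseMap he, phaseMap_one])
    (LinearMap.ext fun x => by
      simp [phaseMap_phaseMap he, phaseMap_one])
  norm_map' := norm_phaseMap he c

/-- The rotation changes a vector only by a multiple of `e ∈ D`, so it neither brings vectors into
`D` nor takes them out. -/
theorem map_phaseEquiv_inf_eq_bot {e : E} (he : ‖e‖ = 1) (c : Circle) {M D : Submodule ℂ E}
    (heD : e ∈ D) (h : M ⊓ D = ⊥) :
    M.map ((phaseEquiv e he c).toLinearEquiv : E →ₗ[ℂ] E) ⊓ D = ⊥ := by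
  rw [Submodule.eq_bot_iff] at h ⊢
  rintro _ ⟨⟨x, hx, rfl⟩, hxD⟩
  change phaseMap e c x ∈ D at hxD
  change phaseMap e c x = 0
  rw [phaseMap_apply] at hxD
  have h1 : x ∈ D := by simpa using D.sub_mem hxD (D.smul_mem ((c - 1) * ⟪e, x⟫_ℂ) heD)
  rw [h x ⟨hx, h1⟩, map_zero]

/-- If two phases gave the same image, some `x ∈ M` not orthogonal to `e` and its rotation by the
quotient phase would both lie in `M`; their difference is a nonzero multiple of `e`. -/
theorem injective_map_phaseEquiv {e : E} (he : ‖e‖ = 1) {M : Submodule ℂ E} (h1 : e ∉ M)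
    (h2 : e ∉ Mᗮ) : Function.Injective fun c : Circle =>
      M.map ((phaseEquiv e he c).toLinearEquiv : E →ₗ[ℂ] E) := by
  intro c d hcd
  by_contra hne
  rw [Submodule.mem_orthogonal] at h2
  push Not at h2
  obtain ⟨x, hx, hxe⟩ := h2
  have hex : ⟪e, x⟫_ℂ ≠ 0 := fun h => hxe (inner_eq_zero_symm.1 h)
  have h3 : phaseMap e c x ∈ M.map ((phaseEquiv e he d).toLinearEquiv : E →ₗ[ℂ] E) := by
    have h : M.map ((phaseEquiv e he c).toLinearEquiv : E →ₗ[ℂ] E)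
        = M.map ((phaseEquiv e he d).toLinearEquiv : E →ₗ[ℂ] E) := hcd
    rw [← h]
    exact ⟨x, hx, rfl⟩
  obtain ⟨y, hy, hyx⟩ := h3
  change phaseMap e d y = phaseMap e c x at hyx
  have h4 : y = phaseMap e ((d⁻¹ : Circle) * c : ℂ) x := by
    rw [← phaseMap_phaseMap he, ← hyx, phaseMap_phaseMap he]
    simp [phaseMap_one]
  have h5 : (((d⁻¹ : Circle) * c : ℂ) - 1) * ⟪e, x⟫_ℂ ≠ 0 := by
    refine mul_ne_zero (fun h => hne ?_) hex
    have h6 : ((d⁻¹ * c : Circle) : ℂ) = (1 : Circle) := by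
      rw [Circle.coe_mul, Circle.coe_one]
      exact sub_eq_zero.1 h
    exact (inv_mul_eq_one.1 (Circle.ext h6)).symm
  rw [phaseMap_apply] at h4
  refine h1 ((M.smul_mem_iff h5).1 ?_)
  have h7 := M.sub_mem hy hx
  rwa [h4, add_sub_cancel_left] at h7

theorem Circle.not_countable : ¬ Countable Circle := by
  intro h
  have hinj : Set.InjOn Circle.exp (Set.Ioc (-Real.pi) Real.pi) := fun x hx y hy hxy => by
    rw [← Circle.arg_exp hx.1 hx.2, ← Circle.arg_exp hy.1 hy.2, hxy]
  have h1 : (Set.Ioc (-Real.pi) Real.pi).Countable :=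
    Set.MapsTo.countable_of_injOn (Set.mapsTo_univ _ _) hinj Set.countable_univ
  have h2 := Cardinal.mk_Ioc_real (show -Real.pi < Real.pi by linarith [Real.pi_pos])
  have h3 := Cardinal.le_aleph0_iff_set_countable.2 h1
  rw [h2] at h3
  exact absurd h3 (not_le.2 Cardinal.aleph0_lt_continuum)

theorem LinearPMap.IsUnbounded.exists_norm_eq_one {H : E →ₗ.[ℂ] E} (h : H.IsUnbounded) :
    ∃ e ∈ H.domain, ‖e‖ = 1 := by
  by_contra! hne
  refine h ⟨0, fun x => ?_⟩
  have hx : x = 0 := by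
    by_contra hx
    have hx' : ‖(x : E)‖ ≠ 0 := norm_ne_zero_iff.2 fun h => hx (Subtype.ext h)
    exact hne ((‖(x : E)‖⁻¹ : ℂ) • (x : E)) (H.domain.smul_mem _ x.2) (by simp [norm_smul, hx'])
  simp [hx]

theorem trivialIntersectionSubspaces_not_countable {H : E →ₗ.[ℂ] E} (hunbounded : H.IsUnbounded)
    (h : (trivialIntersectionSubspaces H).Nonempty) :
    ¬ (trivialIntersectionSubspaces H).Countable := by
  obtain ⟨M, hMc, hM, hMo⟩ := h
  obtain ⟨e, heD, he⟩ := hunbounded.exists_norm_eq_one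
  have he0 : e ≠ 0 := norm_ne_zero_iff.1 (by rw [he]; exact one_ne_zero)
  have h1 : e ∉ M := fun hm => he0 ((Submodule.eq_bot_iff _).1 hM e ⟨hm, heD⟩)
  have h2 : e ∉ Mᗮ := fun hm => he0 ((Submodule.eq_bot_iff _).1 hMo e ⟨hm, heD⟩)
  intro hcount
  refine Circle.not_countable (Set.countable_univ_iff.1 (Set.MapsTo.countable_of_injOn
    (t := trivialIntersectionSubspaces H) (fun c _ => ⟨?_, ?_, ?_⟩)
    (injective_map_phaseEquiv he h1 h2).injOn hcount))
  · exact (phaseEquiv e he c).toHomeomorph.isClosedMap _ hMc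
  · exact map_phaseEquiv_inf_eq_bot he c heD hM
  · rw [← Submodule.map_orthogonal_equiv]
    exact map_phaseEquiv_inf_eq_bot he c heD hMo

end Rotation

/-! ### Reflections and the theorem -/

section Main

variable {E : Type*} [NormedAddCommGroup E] [InnerProductSpace ℂ E] [CompleteSpace E]

/-- The reflection in `M` is a fundamental symmetry that moves the domain off itself. -/
theorem exists_mem_trivialIntersectionSymmetries {H : E →ₗ.[ℂ] E} {M : Submodule ℂ E}
    (hM : M ∈ trivialIntersectionSubspaces H) :
    ∃ J ∈ trivialIntersectionSymmetries H, LinearMap.eqLocus (J : E →ₗ[ℂ] E) LinearMap.id = M := by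
  obtain ⟨hMc, hM, hMo⟩ := hM
  have := hMc.completeSpace_coe
  let J : E →L[ℂ] E := M.reflection.toContinuousLinearEquiv
  have hJJ : ∀ x, J (J x) = x := M.reflection_reflection
  refine ⟨J, ⟨⟨?_, ContinuousLinearMap.ext hJJ⟩, ?_⟩, ?_⟩
  · refine ((ContinuousLinearMap.eq_adjoint_iff _ _).2 fun x y => ?_).symm
    rw [← M.reflection.inner_map_map (J x) y]
    change ⟪J (J x), J y⟫_ℂ = _
    rw [hJJ]
  · rw [Submodule.eq_bot_iff]
    rintro _ ⟨⟨x, hx, rfl⟩, hJx⟩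
    change J x ∈ H.domain at hJx
    change J x = 0
    have hval : J x = 2 • M.starProjection x - x := M.reflection_apply x
    -- With `P` the projection onto `M`, `J x + x = 2 P x` lies in `M` and `J x - x = -2 (x - P x)`
    -- in `Mᗮ`; both also lie in the domain.
    have h1 : J x + x = 0 := (Submodule.eq_bot_iff _).1 hM _ ⟨by
      rw [hval, sub_add_cancel]
      exact M.smul_of_tower_mem 2 (M.starProjection_apply_mem x), H.domain.add_mem hJx hx⟩
    have h2 : J x - x = 0 := (Submodule.eq_bot_iff _).1 hMo _ ⟨by
      have h3 : J x - x = -(2 : ℂ) • (x - M.starProjection x) := by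
        rw [hval]
        module
      rw [h3]
      exact Mᗮ.smul_mem _ (M.sub_starProjection_mem_orthogonal x), H.domain.sub_mem hJx hx⟩
    have h4 : (2 : ℂ) • J x = 0 := by
      rw [two_smul]
      calc J x + J x = (J x + x) + (J x - x) := by abel
        _ = 0 := by rw [h1, h2, add_zero]
    exact (smul_eq_zero.1 h4).resolve_left two_ne_zero
  · ext x
    exact M.reflection_eq_self_iff x

end Main

theorem theorem3p17 {E : Type*} [NormedAddCommGroup E] [InnerProductSpace ℂ E]
    [CompleteSpace E] [TopologicalSpace.SeparableSpace E]
    (H : E →ₗ.[ℂ] E) (hclosed : H.IsClosed) (hdense : Dense (H.domain : Set E))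
    (hunbounded : H.IsUnbounded) :
    ((trivialIntersectionSubspaces H).Nonempty ∧
      ¬ (trivialIntersectionSubspaces H).Countable) ∧
    ((trivialIntersectionSymmetries H).Nonempty ∧
      ¬ (trivialIntersectionSymmetries H).Countable) := by
  have hne := trivialIntersectionSubspaces_nonempty hclosed hdense hunbounded
  have hnc := trivialIntersectionSubspaces_not_countable hunbounded hne
  refine ⟨⟨hne, hnc⟩, ?_, fun hcount => hnc ?_⟩
  · obtain ⟨M, hM⟩ := hne
    obtain ⟨J, hJ, -⟩ := exists_mem_trivialIntersectionSymmetries hM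
    exact ⟨J, hJ⟩
  -- Each `M` is recovered as the fixed space of its reflection, so countably many `J` would leave
  -- only countably many `M`.
  · refine (hcount.image fun J => LinearMap.eqLocus (J : E →ₗ[ℂ] E) LinearMap.id).mono ?_
    intro M hM
    obtain ⟨J, hJ, hJM⟩ := exists_mem_trivialIntersectionSymmetries hM
    exact ⟨J, hJ, hJM⟩
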